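/- For an irrational real number $\alpha$ and a real number $\gamma$ put $$M(\alpha,\gamma)=\liminf_{|n|\to\infty}|n|\,\|n\alpha-\gamma\|,\qquad \rho(\alpha)=\sup_{\gamma\notin\mathbb Z+\alpha\mathbb Z}M(\alpha,\gamma),$$ where $n$ runs through the integers and $\|x\|$ is the distance from $x$ to the nearest integer. Let $\alpha=[a_0;a_1,a_2,\ldots]$ be the regular continued fraction expansion of $\alpha$, with convergents $p_i/q_i=[a_0;a_1,\ldots,a_i]$, let $D_i=|q_i\alpha-p_i|$, let $R=\liminf_{i\to\infty}a_i\in\mathbb N\cup\{\infty\}$, and put $$\gamma_{**}=\sum_{i=1}^{\infty}\tfrac12(a_i+\lambda_i')D_{i-1},\qquad \lambda_i'=\begin{cases}0,& a_i\text{ even},\\ 1,& a_i\text{ odd}\end{cases}$$ (this series converges). If $2\le R<\infty$, let $R_*=R$ if $R$ is odd and $R_*=R+1$ if $R$ is even, and let $\theta_1=\frac12\left(\sqrt{R_*^2+4}-R_*\right)$. Then $$M(\alpha,\gamma_{**})\ \ge\ \frac14\left(1-\frac{2}{R_*}\right)\left(1-2\theta_1^2-\theta_1^3\right)\ \ge\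 \frac14\left(1-\frac{2}{R_*}-\frac{2}{R_*^2}+\frac{3}{R_*^3}\right).$$ If $R=\infty$, then $M(\alpha,\gamma_{**})\ge\frac14$ (the same bound with $1/R_*=\theta_1=0$). In particular, if only finitely many of the partial quotients $a_i$, $i\ge1$, are equal to $1$, then $$\rho(\alpha)\ \ge\ M(\alpha,\gamma_{**})\ \ge\ \frac{1}{2\sqrt{13}+8}.$$ -/

import Mathlib

open Filter

noncomputable section

namespace Inhom

/-- `‖x‖`, the distance from `x` to the nearest integer. -/
def distInt (x : ℝ) : ℝ := |x - (round x : ℝ)|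

/-- The two-sided inhomogeneous approximation constant
`M(α, γ) = liminf_{|n| → ∞} |n| ‖nα - γ‖`, where `n` runs through the integers.
It is taken in the extended reals, so that lower limits and suprema have no default values. -/
def M (α γ : ℝ) : EReal :=
  liminf (fun n : ℤ => ((|(n : ℝ)| * distInt ((n : ℝ) * α - γ) : ℝ) : EReal)) (atBot ⊔ atTop)

/-- `ρ(α)`, the supremum of `M(α, γ)` over the real `γ` that are not in `ℤ + αℤ`. -/
def rho (α : ℝ) : EReal :=
  ⨆ γ ∈ {γ : ℝ | ¬ ∃ m n : ℤ, γ = (m : ℝ) + (n : ℝ) * α}, M α γ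

/-- The partial quotient `a_i` of the regular continued fraction expansion
`α = [a_0; a_1, a_2, …]` (for irrational `α` the expansion is infinite, so the value `0`
of the second case does not occur). -/
def partQuot (α : ℝ) (i : ℕ) : ℤ :=
  match GenContFract.IntFractPair.stream α i with
  | some p => p.b
  | none => 0

/-- `R = liminf a_i`, possibly infinite (the `a_i` with `i ≥ 1` are positive). -/
def liminfPartQuot (α : ℝ) : ℕ∞ :=
  liminf (fun i : ℕ => ((partQuot α i).toNat : ℕ∞)) atTop

/-- `D_i = |q_i α - p_i|`, where `p_i / q_i = [a_0; a_1, …, a_i]` are the convergents of the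
regular continued fraction expansion of `α`. -/
def D (α : ℝ) (i : ℕ) : ℝ :=
  |(GenContFract.of α).dens i * α - (GenContFract.of α).nums i|

/-- `λ'_i`, equal to `0` if `a_i` is even and to `1` if `a_i` is odd. -/
def lam (α : ℝ) (i : ℕ) : ℝ := if Even (partQuot α i) then 0 else 1

/-- The term `½ (a_i + λ'_i) D_{i-1}` with `i = k + 1`. -/
def gammaTerm (α : ℝ) (k : ℕ) : ℝ :=
  (1 / 2) * ((partQuot α (k + 1) : ℝ) + lam α (k + 1)) * D α k

/-- `γ_** = ∑_{i ≥ 1} ½ (a_i + λ'_i) D_{i-1}`. -/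
def gammaStarStar (α : ℝ) : ℝ := ∑' k : ℕ, gammaTerm α k

/-- `R_*`, the least odd integer that is at least `R`. -/
def Rstar (R : ℕ) : ℕ := if Odd R then R else R + 1

/-- `θ_1 = ½ (√(R_*² + 4) - R_*)`. -/
def theta1 (R : ℕ) : ℝ := (1 / 2) * (√((Rstar R : ℝ) ^ 2 + 4) - (Rstar R : ℝ))

end Inhom

end

noncomputable section

namespace Inhom

/-! Up to the factor 4, the products |n| |nα - γ_** - m| are values |xy| on a shifted planar
lattice, with x = `gridX`, y = `gridY` and points labelled by pairs (U, V) of odd integers. Each k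
gives a basis of that lattice, and the points (±1, ±1) form a divided cell, eventually with one
vertex in each closed quadrant. Passing to the next cell replaces (U, V) by (V + aU - λ', U); as λ'
is the parity of a, the coordinates stay odd, and this is what γ_** is designed for.

A point with UV < 0 has |x| ≥ q_k / 2, so this sign cannot persist as k grows. A point with |n|
large and y bounded has UV < 0 in the first cell considered. Hence UV changes from negative to
positive between two consecutive cells. There, for fixed U, the product is concave in V, hence least
at the ends of the admissible range, and the ends are dominated by vertices of the two cells
(`le_mul_of_transition`). It remains to bound the products at vertices.

Divided by q_k and D_{k-1}, the vertices depend on a tail (X, t) and a head (Y, s) of the expansion.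
Eventually even digits are at least R_* - 1 and odd ones at least R_*. The extreme tail has all
digits equal to R_* and yields 1 - 2θ² - θ³; the heads yield 1 - 2/R_* (`Params.tailBounds`,
`Params.headBounds`, `Params.cellBounds`). -/

/-! ### Remainders, the distances D_i and the series for γ_** -/

/-- The successive remainders `{x_i}` of the continued fraction algorithm. -/
def fr (α : ℝ) : ℕ → ℝ
  | 0 => Int.fract α
  | n + 1 => Int.fract (fr α n)⁻¹

theorem irrational_fr {α : ℝ} (hα : Irrational α) (n : ℕ) : Irrational (fr α n) := by
  have key : ∀ x : ℝ, Irrational x → Irrational (Int.fract x) := fun x hx => by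
    have := hx.sub_intCast ⌊x⌋
    exact this
  induction n with
  | zero => exact key _ hα
  | succ n ih => exact key _ (irrational_inv_iff.2 ih)

theorem fr_pos {α : ℝ} (hα : Irrational α) (n : ℕ) : 0 < fr α n := by
  have h0 : 0 ≤ fr α n := by cases n <;> exact Int.fract_nonneg _
  exact lt_of_le_of_ne h0 (irrational_fr hα n).ne_zero.symm

theorem fr_lt_one (α : ℝ) (n : ℕ) : fr α n < 1 := by
  cases n <;> exact Int.fract_lt_one _

theorem exists_stream_eq {α : ℝ} (hα : Irrational α) (n : ℕ) :
    ∃ p, GenContFract.IntFractPair.stream α n = some p ∧ p.fr = fr α n := by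
  induction n with
  | zero => exact ⟨_, GenContFract.IntFractPair.stream_zero α, rfl⟩
  | succ n ih =>
    obtain ⟨p, hp, hf⟩ := ih
    refine ⟨_, GenContFract.IntFractPair.stream_succ_of_some hp ?_, ?_⟩
    · rw [hf]; exact (fr_pos hα n).ne'
    · simp [GenContFract.IntFractPair.of, hf, fr]

theorem partQuot_succ {α : ℝ} (hα : Irrational α) (n : ℕ) :
    partQuot α (n + 1) = ⌊(fr α n)⁻¹⌋ := by
  obtain ⟨p, hp, hf⟩ := exists_stream_eq hα n
  have := GenContFract.IntFractPair.stream_succ_of_some hp (by rw [hf]; exact (fr_pos hα n).ne')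
  simp [partQuot, this, GenContFract.IntFractPair.of, hf]

theorem one_le_partQuot_succ {α : ℝ} (hα : Irrational α) (n : ℕ) : 1 ≤ partQuot α (n + 1) := by
  rw [partQuot_succ hα, Int.le_floor]
  exact_mod_cast (one_lt_inv₀ (fr_pos hα n)).2 (fr_lt_one α n) |>.le

theorem fr_mul {α : ℝ} (hα : Irrational α) (n : ℕ) :
    fr α n * (partQuot α (n + 1) + fr α (n + 1)) = 1 := by
  rw [partQuot_succ hα, fr, Int.floor_add_fract, mul_inv_cancel₀ (fr_pos hα n).ne']

/-- `D_{k-1}` as a product of remainders. -/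
def dd (α : ℝ) : ℕ → ℝ
  | 0 => 1
  | k + 1 => fr α k * dd α k

theorem dd_pos {α : ℝ} (hα : Irrational α) (k : ℕ) : 0 < dd α k := by
  induction k with
  | zero => exact one_pos
  | succ k ih => exact mul_pos (fr_pos hα k) ih

theorem dd_rec {α : ℝ} (hα : Irrational α) (k : ℕ) :
    dd α k = partQuot α (k + 1) * dd α (k + 1) + dd α (k + 2) := by
  have h := fr_mul hα k
  simp only [dd]
  linear_combination (-dd α k) * h

/-- The exact complete quotient writes α as a fraction in two consecutive convergents; solving for
the newer error shows that it is -x_n times the older one. -/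
theorem abs_contsAux {α : ℝ} (hα : Irrational α) (n : ℕ) :
    |((GenContFract.of α).contsAux n).b * α - ((GenContFract.of α).contsAux n).a| = dd α n := by
  induction n with
  | zero => simp [dd, GenContFract.zeroth_contAux_eq_one_zero]
  | succ n ih =>
    obtain ⟨p, hp, hf⟩ := exists_stream_eq hα n
    have h := GenContFract.compExactValue_correctness_of_stream_eq_some hp
    have hpos := fr_pos hα n
    rw [GenContFract.compExactValue, hf, if_neg hpos.ne'] at h
    simp only [GenContFract.nextConts, GenContFract.nextNum, GenContFract.nextDen, one_mul] at h
    set A := (GenContFract.of α).contsAux n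
    set B := (GenContFract.of α).contsAux (n + 1)
    have hne : (fr α n)⁻¹ * B.b + A.b ≠ 0 := fun h0 => by
      rw [h0, div_zero] at h
      exact hα.ne_zero h
    rw [eq_div_iff hne] at h
    have h2 : B.b * α - B.a = -(fr α n) * (A.b * α - A.a) := by
      have h3 : fr α n * (fr α n)⁻¹ = 1 := mul_inv_cancel₀ hpos.ne'
      linear_combination (fr α n) * h - (B.b * α - B.a) * h3
    rw [h2, abs_mul, abs_neg, abs_of_pos hpos, ih, dd]

theorem D_eq_dd {α : ℝ} (hα : Irrational α) (k : ℕ) : D α k = dd α (k + 1) := by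
  rw [D, GenContFract.den_eq_conts_b, GenContFract.num_eq_conts_a,
    GenContFract.nth_cont_eq_succ_nth_contAux, abs_contsAux hα]

theorem partQuot_zero (α : ℝ) : partQuot α 0 = ⌊α⌋ := by
  simp [partQuot, GenContFract.IntFractPair.stream_zero, GenContFract.IntFractPair.of]

theorem lam_eq (α : ℝ) (k : ℕ) : lam α k = 0 ∧ Even (partQuot α k) ∨
    lam α k = 1 ∧ Odd (partQuot α k) := by
  unfold lam
  split_ifs with h
  · exact Or.inl ⟨rfl, h⟩
  · exact Or.inr ⟨rfl, Int.not_even_iff_odd.1 h⟩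

theorem lam_nonneg (α : ℝ) (k : ℕ) : 0 ≤ lam α k := by
  rcases lam_eq α k with h | h <;> simp [h.1]

theorem lam_le_partQuot {α : ℝ} (hα : Irrational α) (k : ℕ) :
    lam α (k + 1) ≤ partQuot α (k + 1) := by
  have : (1 : ℝ) ≤ partQuot α (k + 1) := by exact_mod_cast one_le_partQuot_succ hα k
  rcases lam_eq α (k + 1) with h | h <;> rw [h.1] <;> linarith

theorem sum_partQuot_mul_dd {α : ℝ} (hα : Irrational α) (k n : ℕ) :
    ∑ i ∈ Finset.range n, (partQuot α (i + k + 1) : ℝ) * dd α (i + k + 1) =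
      dd α k + dd α (k + 1) - dd α (n + k) - dd α (n + k + 1) := by
  induction n with
  | zero => simp
  | succ n ih =>
    rw [Finset.sum_range_succ, ih]
    have := dd_rec hα (n + k)
    rw [show n + 1 + k = n + k + 1 by ring]
    linarith

theorem partQuot_mul_dd_nonneg {α : ℝ} (hα : Irrational α) (k : ℕ) :
    0 ≤ (partQuot α (k + 1) : ℝ) * dd α (k + 1) := by
  have : (1 : ℝ) ≤ partQuot α (k + 1) := by exact_mod_cast one_le_partQuot_succ hα k
  exact mul_nonneg (by linarith) (dd_pos hα _).le

theorem summable_partQuot_mul_dd {α : ℝ} (hα : Irrational α) (k : ℕ) :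
    Summable fun i => (partQuot α (i + k + 1) : ℝ) * dd α (i + k + 1) := by
  refine summable_of_sum_range_le (c := dd α k + dd α (k + 1))
    (fun i => partQuot_mul_dd_nonneg hα _) fun n => ?_
  rw [sum_partQuot_mul_dd hα]
  linarith [dd_pos hα (n + k), dd_pos hα (n + k + 1)]

theorem tendsto_dd {α : ℝ} (hα : Irrational α) : Tendsto (dd α) atTop (nhds 0) := by
  rw [← tendsto_add_atTop_iff_nat 1]
  refine squeeze_zero (fun n => (dd_pos hα _).le) (fun n => ?_)
    (summable_partQuot_mul_dd hα 0).tendsto_atTop_zero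
  have : (1 : ℝ) ≤ partQuot α (n + 1) := by exact_mod_cast one_le_partQuot_succ hα n
  exact le_mul_of_one_le_left (dd_pos hα _).le this

theorem hasSum_partQuot_mul_dd {α : ℝ} (hα : Irrational α) (k : ℕ) :
    HasSum (fun i => (partQuot α (i + k + 1) : ℝ) * dd α (i + k + 1))
      (dd α k + dd α (k + 1)) := by
  rw [hasSum_iff_tendsto_nat_of_nonneg fun i => partQuot_mul_dd_nonneg hα _]
  simp only [sum_partQuot_mul_dd hα]
  have h1 := (tendsto_dd hα).comp (tendsto_add_atTop_nat k)
  have h2 := (tendsto_dd hα).comp (tendsto_add_atTop_nat (k + 1))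
  have := ((tendsto_const_nhds (x := dd α k + dd α (k + 1))).sub h1).sub h2
  simpa [← add_assoc] using this

theorem summable_lam_mul_dd {α : ℝ} (hα : Irrational α) (k : ℕ) :
    Summable fun i => lam α (i + k + 1) * dd α (i + k + 1) :=
  (summable_partQuot_mul_dd hα k).of_nonneg_of_le
    (fun _ => mul_nonneg (lam_nonneg _ _) (dd_pos hα _).le)
    fun _ => mul_le_mul_of_nonneg_right (lam_le_partQuot hα _) (dd_pos hα _).le

/-- The tail `∑_{i > k} λ'_i D_{i-1}`. -/
def oddTail (α : ℝ) (k : ℕ) : ℝ := ∑' i, lam α (i + k + 1) * dd α (i + k + 1)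

theorem oddTail_rec {α : ℝ} (hα : Irrational α) (k : ℕ) :
    oddTail α k = lam α (k + 1) * dd α (k + 1) + oddTail α (k + 1) := by
  rw [oddTail, (summable_lam_mul_dd hα k).tsum_eq_zero_add, oddTail]
  simp only [zero_add]
  congr 2
  funext i
  rw [show i + 1 + k + 1 = i + (k + 1) + 1 by ring]

theorem oddTail_nonneg {α : ℝ} (hα : Irrational α) (k : ℕ) : 0 ≤ oddTail α k :=
  tsum_nonneg fun _ => mul_nonneg (lam_nonneg _ _) (dd_pos hα _).le

theorem oddTail_le {α : ℝ} (hα : Irrational α) (k : ℕ) :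
    oddTail α k ≤ dd α k + dd α (k + 1) := by
  rw [← (hasSum_partQuot_mul_dd hα k).tsum_eq]
  exact (summable_lam_mul_dd hα k).tsum_le_tsum
    (fun i => mul_le_mul_of_nonneg_right (lam_le_partQuot hα _) (dd_pos hα _).le)
    (summable_partQuot_mul_dd hα k)

/-- The series of a_i D_{i-1} telescopes to 1 + D_0, so only the digits of odd parity leave a
genuine series. -/
theorem hasSum_gammaTerm {α : ℝ} (hα : Irrational α) :
    HasSum (gammaTerm α) ((1 / 2) * (1 + dd α 1 + oddTail α 0)) := by
  have h := ((hasSum_partQuot_mul_dd hα 0).add (summable_lam_mul_dd hα 0).hasSum).mul_left (1 / 2)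
  refine (h.congr_fun ?_)
  intro i
  simp only [gammaTerm, D_eq_dd hα, add_zero]
  ring

/-! ### Denominators and the alternating shift -/

/-- Denominators of the convergents: `den α k = q_{k-1}`. -/
def den (α : ℝ) : ℕ → ℝ
  | 0 => 0
  | 1 => 1
  | k + 2 => partQuot α (k + 1) * den α (k + 1) + den α k

theorem den_pos {α : ℝ} (hα : Irrational α) (k : ℕ) : 0 ≤ den α k ∧ 0 < den α (k + 1) := by
  induction k with
  | zero => simp [den]
  | succ k ih =>
    refine ⟨ih.2.le, ?_⟩
    have : (1 : ℝ) ≤ partQuot α (k + 1) := by exact_mod_cast one_le_partQuot_succ hα k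
    rw [den]
    nlinarith [ih.1, ih.2]

theorem den_mul_dd {α : ℝ} (hα : Irrational α) (k : ℕ) :
    den α (k + 1) * dd α k + den α k * dd α (k + 1) = 1 := by
  induction k with
  | zero => simp [den, dd]
  | succ k ih =>
    have := dd_rec hα k
    rw [den]
    linear_combination ih - den α (k + 1) * this

theorem le_den {α : ℝ} (hα : Irrational α) (k : ℕ) : (k : ℝ) ≤ den α (k + 1) + 1 := by
  have mono : ∀ k, den α k + den α (k + 1) ≤ den α (k + 2) := fun k => by
    have : (1 : ℝ) ≤ partQuot α (k + 1) := by exact_mod_cast one_le_partQuot_succ hα k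
    rw [den]
    nlinarith [den_pos hα k]
  have one : ∀ k, 1 ≤ den α (k + 1) := fun k => by
    induction k with
    | zero => simp [den]
    | succ k ih => linarith [mono k, den_pos hα k]
  induction k with
  | zero => linarith [Nat.cast_zero (R := ℝ), one 0]
  | succ k ih =>
    push_cast
    cases k with
    | zero => simp; linarith [one 1]
    | succ k => linarith [mono (k + 1), one k]

/-- The alternating sum `± (1 + ∑_{i ≤ k} (-1)^(i-1) λ'_i q_{i-1})`. -/
def oddShift (α : ℝ) : ℕ → ℝ
  | 0 => 1
  | k + 1 => -oddShift α k - lam α (k + 1) * den α (k + 1)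

/-! ### The extremal periodic expansion -/

/-- Numerical parameters of the extremal periodic expansion: `θ = [0; N, N, …]`,
`τ = θ / (1 - θ)`, `r = 1 / N` and `ρ = 1 / (N - 1)`. -/
structure Params (N θ τ r ρ : ℝ) : Prop where
  three_le : 3 ≤ N
  theta_pos : 0 < θ
  theta_eq : θ * (N + θ) = 1
  tau_eq : τ * (1 - θ) = θ
  r_eq : r * N = 1
  rho_eq : ρ * (N - 1) = 1

namespace Params

variable {N θ τ r ρ : ℝ}

theorem r_pos (h : Params N θ τ r ρ) : 0 < r := by
  have := h.r_eq; have := h.three_le; by_contra hc; nlinarith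

theorem r_le (h : Params N θ τ r ρ) : r ≤ 1 / 3 := by
  have := h.r_eq; have := h.three_le; have := h.r_pos; nlinarith

theorem rho_pos (h : Params N θ τ r ρ) : 0 < ρ := by
  have := h.rho_eq; have := h.three_le; by_contra hc; nlinarith

theorem rho_le (h : Params N θ τ r ρ) : ρ ≤ 1 / 2 := by
  have := h.rho_eq; have := h.three_le; have := h.rho_pos; nlinarith

theorem rho_le_two_r (h : Params N θ τ r ρ) : ρ ≤ 2 * r := by
  have h1 : r * (N - 1) ≥ r * N * (1 / 2) := by nlinarith [h.r_pos, h.three_le]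
  have := h.rho_eq; have := h.r_eq; have := h.three_le
  nlinarith

theorem one_sub_two_r (h : Params N θ τ r ρ) : 1 - 2 * r = (1 - ρ) * (1 - r) := by
  linear_combination r * h.rho_eq - ρ * h.r_eq

theorem theta_sq (h : Params N θ τ r ρ) : θ ^ 2 + 3 * θ ≤ 1 := by
  have := h.theta_eq; have := h.three_le; have := h.theta_pos; nlinarith

theorem theta_le (h : Params N θ τ r ρ) : θ ≤ 1 / 3 := by
  have := h.theta_sq; nlinarith [h.theta_pos]

theorem theta_le_r (h : Params N θ τ r ρ) : θ ≤ r := by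
  have := h.theta_eq; have := h.r_eq; have := h.three_le
  nlinarith [h.theta_pos]

theorem tau_pos (h : Params N θ τ r ρ) : 0 < τ := by
  have := h.tau_eq; have := h.theta_le; have := h.theta_pos
  by_contra hc; nlinarith

theorem tau_le (h : Params N θ τ r ρ) : τ ≤ 1 / 2 := by
  have := h.tau_eq; have := h.theta_le; have := h.theta_pos
  nlinarith

theorem r_mul (h : Params N θ τ r ρ) : r * (1 - θ ^ 2) = θ := by
  linear_combination (-r) * h.theta_eq + θ * h.r_eq

theorem tau_mul_N (h : Params N θ τ r ρ) : τ * N = 1 + θ := by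
  have h1 : θ * (τ * N) = θ * (1 + θ) := by
    linear_combination τ * h.theta_eq + (1 + θ) * h.tau_eq
  exact mul_left_cancel₀ h.theta_pos.ne' h1

theorem r_mul_one_add_theta (h : Params N θ τ r ρ) : r * (1 + θ) = τ := by
  rw [← h.tau_mul_N]; linear_combination τ * h.r_eq

/-- The factor `1 - 2θ² - θ³` of the bound. -/
theorem kappa_bounds (h : Params N θ τ r ρ) :
    0 < 1 - 2 * θ ^ 2 - θ ^ 3 ∧ 1 - 2 * θ ^ 2 - θ ^ 3 ≤ 1 := by
  have := h.theta_le; have := h.theta_pos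
  constructor <;> nlinarith [mul_pos h.theta_pos h.theta_pos, pow_pos h.theta_pos 3]

/-- After multiplication by 1 - θ the difference of the two sides is θ²(1 - 3θ - θ²), which is
nonnegative because N ≥ 3. -/
theorem bound_le (h : Params N θ τ r ρ) :
    (1 - 2 * r) * (1 - 2 * θ ^ 2 - θ ^ 3) ≤ 1 - (θ + τ) := by
  have hθ := h.theta_le
  have h1 : 0 < 1 - θ := by linarith
  have h2 : 0 < 1 - θ ^ 2 := by nlinarith [h.theta_pos]
  have e1 : (1 - 2 * r) * (1 - θ ^ 2) = 1 - 2 * θ - θ ^ 2 := by linear_combination -2 * h.r_mul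
  have e2 : (1 - 2 * r) * (1 - 2 * θ ^ 2 - θ ^ 3) * (1 - θ) =
      (1 - 2 * θ - θ ^ 2) * (1 - θ - θ ^ 2) := by
    linear_combination (1 - θ - θ ^ 2) * e1
  have e3 : (1 - (θ + τ)) * (1 - θ) = 1 - 3 * θ + θ ^ 2 := by linear_combination -h.tau_eq
  have h4 : 0 ≤ θ ^ 2 * (1 - 3 * θ - θ ^ 2) :=
    mul_nonneg (sq_nonneg _) (by linarith [h.theta_sq])
  refine le_of_mul_le_mul_right ?_ h1
  rw [e2, e3]
  nlinarith

theorem bound_pos (h : Params N θ τ r ρ) : 0 < (1 - 2 * r) * (1 - 2 * θ ^ 2 - θ ^ 3) :=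
  mul_pos (by linarith [h.r_le]) h.kappa_bounds.1

theorem bound_le_one_sub (h : Params N θ τ r ρ) :
    (1 - 2 * r) * (1 - 2 * θ ^ 2 - θ ^ 3) ≤ 1 - 2 * r :=
  mul_le_of_le_one_right (by linarith [h.r_le]) h.kappa_bounds.2

/-- The two constraints on a tail `t` imply the supporting inequalities in between. -/
theorem tail_le (h : Params N θ τ r ρ) {X t δ : ℝ} (h1 : t ≤ τ) (h2 : t ≤ (1 + τ) * X)
    (hδ : 0 ≤ δ) (hδ' : δ ≤ 1 + τ) : t ≤ τ + δ * (X - θ) := by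
  have := h.tau_pos
  -- The bounds τ and (1 + τ)X cross at X = θ; they are combined with weights 1 + τ - δ and δ,
  -- giving the line of slope δ through (θ, τ).
  have key : (1 + τ) * t ≤ (1 + τ) * (τ + δ * (X - θ)) := by
    have e : (1 + τ) * θ = τ := by linear_combination -h.tau_eq
    have a1 := mul_nonneg (sub_nonneg.2 hδ') (sub_nonneg.2 h1)
    have a2 := mul_nonneg hδ (sub_nonneg.2 h2)
    have e2 : (1 + τ) * (τ + δ * (X - θ)) = (1 + τ) * τ + (1 + τ) * δ * X - δ * τ := by
      linear_combination -δ * e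
    rw [e2]; nlinarith
  exact le_of_mul_le_mul_left key (by linarith)

end Params

/-! ### Tails with admissible digits -/

/-- Admissible digits: `l` is the parity of the partial quotient `a`. -/
def Admissible (N a l : ℝ) : Prop := l = 0 ∧ N - 1 ≤ a ∨ l = 1 ∧ N ≤ a

theorem Admissible.le {N a l : ℝ} (h : Admissible N a l) : N - 1 ≤ a := by
  rcases h with h | h <;> linarith

section Tails

variable {N θ τ r ρ a l X X' t t' : ℝ}

theorem Params.quotient_pos (h : Params N θ τ r ρ) (hA : Admissible N a l) (hX' : 0 ≤ X')
    (e : X * (a + X') = 1) : 0 < X := by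
  have h1 := hA.le
  have h3 := h.three_le
  exact pos_of_mul_pos_left (by rw [e]; exact one_pos) (by linarith : 0 ≤ a + X')

theorem Params.quotient_le (h : Params N θ τ r ρ) (hA : Admissible N a l) (hX' : 0 ≤ X')
    (hX : 0 < X) (e : X * (a + X') = 1) : X ≤ ρ := by
  have h1 := hA.le
  have h3 := h.three_le
  have h2 : X * (N - 1) ≤ 1 := by nlinarith [mul_nonneg hX.le hX']
  have := h.rho_eq
  by_contra hc
  nlinarith

theorem Params.quotient_le_of_odd (h : Params N θ τ r ρ) (hA : N ≤ a) (hX' : 0 ≤ X')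
    (hX : 0 < X) (e : X * (a + X') = 1) : X ≤ r := by
  have h3 := h.three_le
  have h2 : X * N ≤ 1 := by nlinarith [mul_nonneg hX.le hX']
  have := h.r_eq
  by_contra hc
  nlinarith

theorem mul_le_of_le_mul {X b c s : ℝ} (hX : 0 < X) (e : X * b = 1) (h : s ≤ c * b) :
    X * s ≤ c := by
  calc X * s ≤ X * (c * b) := mul_le_mul_of_nonneg_left h hX.le
    _ = c := by linear_combination c * e

/-- The recursion for tails contracts the excess over τ. An even digit gains from a + X' ≥ 2; for an
odd digit the two hypotheses are averaged with weights 1 - θ and θ, which is exact on the periodic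
tail when c = 0. -/
theorem Params.tail_halve (h : Params N θ τ r ρ) (hA : Admissible N a l) (hX' : 0 < X')
    (hX : 0 < X) (e : X * (a + X') = 1) (et : t = X * (l + t')) {c : ℝ} (hc : 0 ≤ c)
    (h1 : t' ≤ τ + c) (h2 : t' ≤ (1 + τ + c) * X') : t ≤ τ + c / 2 := by
  have hτ := h.tau_pos
  have hθ := h.theta_pos
  have hθ' := h.theta_le
  have hN := h.three_le
  rw [et]
  rcases hA with ⟨rfl, ha⟩ | ⟨rfl, ha⟩
  · refine mul_le_of_le_mul hX e ?_
    have := mul_nonneg (add_nonneg hτ.le (by linarith : 0 ≤ c / 2))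
      (by linarith : 0 ≤ a + X' - 2)
    linarith
  · refine mul_le_of_le_mul hX e ?_
    have a1 := mul_le_mul_of_nonneg_left h1 (by linarith : 0 ≤ 1 - θ)
    have a2 := mul_le_mul_of_nonneg_left h2 hθ.le
    have e3 : (1 + τ) * θ = τ := by linear_combination -h.tau_eq
    have b1 : t' ≤ θ + (1 - θ) * c + τ * X' + θ * c * X' := by
      have : θ * ((1 + τ + c) * X') = τ * X' + θ * c * X' := by linear_combination X' * e3
      have : (1 - θ) * (τ + c) = θ + (1 - θ) * c := by linear_combination h.tau_eq
      linarith
    have b2 : (τ + c / 2) * (N + X') ≤ (τ + c / 2) * (a + X') :=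
      mul_le_mul_of_nonneg_left (by linarith) (by linarith)
    have b3 := h.tau_mul_N
    have b4 : θ * c * X' ≤ 1 / 2 * c * X' := by
      gcongr; linarith
    have b5 := mul_nonneg hc (by linarith : 0 ≤ N - 3)
    have b6 := mul_nonneg hθ.le hc
    linarith

theorem Params.tail_le_mul (hA : Admissible N a l) (hX : 0 < X)
    (et : t = X * (l + t')) {c : ℝ} (h1 : t' ≤ τ + c) : t ≤ (1 + τ + c) * X := by
  have hl : l ≤ 1 := by rcases hA with ⟨rfl, _⟩ | ⟨rfl, _⟩ <;> norm_num
  rw [et, mul_comm]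
  exact mul_le_mul_of_nonneg_right (by linarith) hX.le

/-- Bounds for the tail `t` of an admissible expansion with first quotient `X`. -/
structure TailBounds (N θ τ r ρ X t : ℝ) : Prop where
  pos : 0 < X
  le_rho : X ≤ ρ
  nonneg : 0 ≤ t
  le_r : t ≤ r * (1 + X)
  kappa : (1 - 2 * θ ^ 2 - θ ^ 3) * (1 + r * X) ≤ 1 + X - t
  add_le : X + t ≤ θ + τ

/-- The bounds `le_r`, `kappa` and `add_le` come from lines through the extremal point (θ, τ),
supplied by `tail_le` with slopes r, 2θ² + θ³ and θ + τ. -/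
theorem Params.tailBounds (h : Params N θ τ r ρ) (hA : Admissible N a l) (hX' : 0 < X')
    (hX : 0 < X) (e : X * (a + X') = 1) (et : t = X * (l + t')) (ht' : 0 ≤ t')
    (h1 : t' ≤ τ) (h2 : t' ≤ (1 + τ) * X') : TailBounds N θ τ r ρ X t := by
  have hτ := h.tau_pos
  have hτ' := h.tau_le
  have hθ := h.theta_pos
  have hθ' := h.theta_le
  have hN := h.three_le
  have hr := h.r_pos
  have hr' := h.r_le
  have hl : 0 ≤ l := by rcases hA with ⟨rfl, _⟩ | ⟨rfl, _⟩ <;> norm_num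
  have e3 : (1 + τ) * θ = τ := by linear_combination -h.tau_eq
  have t1 : t ≤ τ := by
    have := h.tail_halve hA hX' hX e et le_rfl (by linarith) (by linarith)
    linarith
  have t2 : t ≤ (1 + τ) * X := by
    have := Params.tail_le_mul (τ := τ) (c := 0) hA hX et (by linarith)
    linarith
  refine ⟨hX, h.quotient_le hA hX'.le hX e, ?_, ?_, ?_, ?_⟩
  · rw [et]; positivity
  · have := h.tail_le t1 t2 hr.le (by linarith)
    have := h.r_mul_one_add_theta
    nlinarith
  · set δ := 2 * θ ^ 2 + θ ^ 3 with hδ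
    have hδ0 : 0 ≤ δ := by positivity
    have hδ1 : δ ≤ 1 := by have := h.kappa_bounds.1; linarith
    rw [show 1 - 2 * θ ^ 2 - θ ^ 3 = 1 - δ by rw [hδ]; ring]
    have hprod : 0 ≤ (1 - δ) * r := mul_nonneg (by linarith) hr.le
    rw [et]
    rcases hA with ⟨rfl, ha⟩ | ⟨rfl, ha⟩
    · have : (1 - δ) * r ≤ 1 - t' := by nlinarith
      nlinarith
    · have key := h.tail_le (δ := δ) h1 h2 hδ0 (by linarith)
      -- This identity fixes δ: it makes the required inequality an equality for X = θ, t' = τ, a =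
      -- N.
      have e4 : τ + (1 - δ) * r = δ * (N + θ) := by
        have q1 : δ * (N + θ) = 2 * θ + θ ^ 2 := by
          rw [hδ]; linear_combination (2 * θ + θ ^ 2) * h.theta_eq
        have q2 : (1 - δ) * r = (1 - θ - θ ^ 2) * τ := by
          rw [hδ, ← h.r_mul_one_add_theta]; ring
        rw [q1, q2]
        linear_combination (2 + θ) * h.tau_eq
      have k2 : X * (t' + (1 - δ) * r) ≤ δ := by
        refine mul_le_of_le_mul hX e ?_
        nlinarith [mul_nonneg hδ0 (by linarith : 0 ≤ a - N)]
      nlinarith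
  · have key := h.tail_le (δ := θ + τ) h1 h2 (by linarith) (by linarith)
    have e4 : 2 + τ = (θ + τ) * (N + θ) := by
      linear_combination -(1 : ℝ) * h.theta_eq - h.tau_mul_N - e3
    rw [et]
    have k2 : X * (1 + l + t') ≤ θ + τ := by
      refine mul_le_of_le_mul hX e ?_
      rcases hA with ⟨rfl, ha⟩ | ⟨rfl, ha⟩
      · nlinarith [mul_nonneg (by linarith : 0 ≤ θ + τ) (by linarith : 0 ≤ a - (N - 1))]
      · nlinarith [mul_nonneg (by linarith : 0 ≤ θ + τ) (by linarith : 0 ≤ a - N)]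
    linarith

end Tails

/-! ### Alternating heads -/

section Heads

variable {N θ τ r ρ a l Y Y' s s' : ℝ}

theorem Params.neg_le_head (h : Params N θ τ r ρ) (hA : Admissible N a l) (hY' : 0 ≤ Y')
    (e : Y * (a + Y') = 1) (es : s = -Y * (l + s')) (h2 : s' ≤ ρ) : -ρ ≤ s := by
  have hN := h.three_le
  have ha := hA.le
  have hρ := h.rho_pos
  have hρ' := h.rho_le
  have hY := h.quotient_pos hA hY' e
  have hYρ := h.quotient_le hA hY' hY e
  rw [es]
  rcases hA with ⟨rfl, ha⟩ | ⟨rfl, ha⟩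
  · have b1 : Y * s' ≤ Y * ρ := mul_le_mul_of_nonneg_left h2 hY.le
    have b2 : Y * ρ ≤ 1 * ρ := mul_le_mul_of_nonneg_right (by linarith) hρ.le
    linarith
  · have : Y * (1 + s') ≤ ρ := by
      refine mul_le_of_le_mul hY e ?_
      have b1 := h.rho_eq
      have b2 : ρ * (N + Y') ≤ ρ * (a + Y') := mul_le_mul_of_nonneg_left (by linarith) hρ.le
      have b3 := mul_nonneg hρ.le hY'
      linarith
    linarith

/-- First-level bounds for the alternating head `s`. -/
structure HeadPre (N ρ Y s : ℝ) : Prop where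
  nonneg : 0 ≤ Y
  le_rho : Y ≤ ρ
  neg_rho_le : -ρ ≤ s
  le_mul : s ≤ ρ * Y

theorem Params.headPre (h : Params N θ τ r ρ) (hA : Admissible N a l) (hY' : 0 ≤ Y')
    (e : Y * (a + Y') = 1) (es : s = -Y * (l + s')) (h1 : -ρ ≤ s') (h2 : s' ≤ ρ) :
    HeadPre N ρ Y s := by
  have hN := h.three_le
  have ha := hA.le
  have hρ := h.rho_pos
  have hρ' := h.rho_le
  have hY := h.quotient_pos hA hY' e
  have hYρ := h.quotient_le hA hY' hY e
  refine ⟨hY.le, hYρ, h.neg_le_head hA hY' e es h2, ?_⟩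
  rw [es]
  rcases hA with ⟨rfl, ha⟩ | ⟨rfl, ha⟩
  · have := mul_le_mul_of_nonneg_left h1 hY.le
    linarith
  · have := mul_nonneg hY.le (by linarith : 0 ≤ 1 + s' + ρ)
    linarith

theorem Params.head_le (h : Params N θ τ r ρ) (hA : Admissible N a l) (hY' : 0 ≤ Y')
    (e : Y * (a + Y') = 1) (es : s = -Y * (l + s')) (h1 : |s'| ≤ 1) : s ≤ ρ := by
  have hN := h.three_le
  have ha := hA.le
  have hY := h.quotient_pos hA hY' e
  have hYρ := h.quotient_le hA hY' hY e
  have := abs_le.1 h1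
  rw [es]
  rcases hA with ⟨rfl, ha⟩ | ⟨rfl, ha⟩
  · have := mul_le_mul_of_nonneg_left this.1 hY.le
    linarith
  · have := mul_nonneg hY.le (by linarith : 0 ≤ 1 + s')
    linarith [h.rho_pos]

/-- The constant 2/3 is not sharp; any limiting bound below 1 would start the refinement in
`exists_headBounds`. -/
theorem Params.abs_head_le (h : Params N θ τ r ρ) (hA : Admissible N a l) (hY' : 0 ≤ Y')
    (e : Y * (a + Y') = 1) (es : s = -Y * (l + s')) {c : ℝ} (hc : 0 ≤ c)
    (h1 : |s'| ≤ 2 / 3 + c) : |s| ≤ 2 / 3 + c / 2 := by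
  have hN := h.three_le
  have ha := hA.le
  have hY := h.quotient_pos hA hY' e
  have hYρ := (h.quotient_le hA hY' hY e).trans h.rho_le
  obtain ⟨h3, h4⟩ := abs_le.1 h1
  have hs : |s| = Y * |l + s'| := by rw [es, abs_mul, abs_neg, abs_of_pos hY]
  rw [hs]
  rcases hA with ⟨rfl, ha⟩ | ⟨rfl, ha⟩
  · rw [zero_add]
    linarith [mul_le_mul_of_nonneg_right hYρ (abs_nonneg s')]
  · have hYr := (h.quotient_le_of_odd ha hY' hY e).trans h.r_le
    have : |1 + s'| ≤ 5 / 3 + c := abs_le.2 ⟨by linarith, by linarith⟩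
    linarith [mul_le_mul_of_nonneg_right hYr (abs_nonneg (1 + s'))]

/-- Bounds for the head `s` used in the estimates at the vertices. -/
structure HeadBounds (N r ρ Y s : ℝ) : Prop extends HeadPre N ρ Y s where
  upper : (Y ≤ r ∧ 1 - 2 * r ≤ 1 - Y + s) ∨ 1 - ρ ≤ 1 - Y + s
  lower : 1 - 2 * r ≤ 1 - Y - s
  outer : -(ρ * Y) ≤ s ∨ (Y ≤ r ∧ -(r * ρ ^ 2) ≤ Y + s)

/-- If the last digit is odd, the term l = 1 makes s negative and Y ≤ r. If it is even, s = -Y s',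
and how negative s' can be depends on the digit before it, so two digits must be examined. -/
theorem Params.headBounds (h : Params N θ τ r ρ) {a' l' Y'' s'' : ℝ} (hA' : Admissible N a' l')
    (hA : Admissible N a l) (hp'' : HeadPre N ρ Y'' s'')
    (e' : Y' * (a' + Y'') = 1) (es' : s' = -Y' * (l' + s''))
    (e : Y * (a + Y') = 1) (es : s = -Y * (l + s')) : HeadBounds N r ρ Y s := by
  have hN := h.three_le
  have hρ := h.rho_pos
  have hρ' := h.rho_le
  have hr := h.r_pos
  have hr' := h.r_le
  have hρr := h.rho_le_two_r
  have eN := h.r_eq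
  have eρ := h.rho_eq
  have s''le : s'' ≤ ρ := by nlinarith [hp''.le_mul, hp''.le_rho, hp''.nonneg]
  have hp' := h.headPre hA' hp''.nonneg e' es' hp''.neg_rho_le s''le
  have s'le : s' ≤ ρ ^ 2 := by nlinarith [hp'.le_mul, hp'.le_rho, hp'.nonneg]
  have s'le' : s' ≤ ρ := by nlinarith
  have hp := h.headPre hA hp'.nonneg e es hp'.neg_rho_le s'le'
  have ha := hA.le
  have ha' := hA'.le
  have hY := h.quotient_pos hA hp'.nonneg e
  have hY' := h.quotient_pos hA' hp''.nonneg e'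
  have hlow := hp'.neg_rho_le
  have hmul := hp'.le_mul
  have hY'ρ := hp'.le_rho
  refine ⟨hp, ?_, ?_, ?_⟩
  · rcases hA with ⟨rfl, ha⟩ | ⟨rfl, ha⟩
    · right
      have : Y * (1 + s') ≤ ρ := by
        refine mul_le_of_le_mul hY e ?_
        nlinarith
      rw [es]; linarith
    · left
      have : Y * (2 + s') ≤ 2 * r := by
        refine mul_le_of_le_mul hY e ?_
        nlinarith
      refine ⟨h.quotient_le_of_odd ha hp'.nonneg hY e, ?_⟩
      rw [es]; linarith
  · rcases hA with ⟨rfl, ha⟩ | ⟨rfl, ha⟩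
    · have key : -(N * s') ≤ N - 2 + 2 * Y' := by
        rcases hA' with ⟨rfl, ha'⟩ | ⟨rfl, ha'⟩
        · have h1 : -s' ≤ ρ ^ 2 := by rw [es']; nlinarith
          have h2 : N * ρ = 1 + ρ := by linarith
          have h3 : N * ρ ^ 2 = ρ + ρ ^ 2 := by linear_combination ρ * h2
          nlinarith
        · have hYr := h.quotient_le_of_odd ha' hp''.nonneg hY' e'
          have h1 : N * Y' ≤ 1 := by nlinarith
          have h2 : -(N * s') - 2 * Y' = (N - 2) * Y' + N * Y' * s'' := by rw [es']; ring
          have h3 : (N - 2) * Y' ≤ (N - 2) * r := mul_le_mul_of_nonneg_left hYr (by linarith)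
          have h4 : N * Y' * s'' ≤ ρ := by
            have : N * Y' * s'' ≤ N * Y' * ρ :=
              mul_le_mul_of_nonneg_left s''le (by positivity)
            nlinarith
          nlinarith
      have : Y * (1 - s') ≤ 2 * r := by
        refine mul_le_of_le_mul hY e ?_
        have : 1 - s' ≤ 2 * r * (N - 1 + Y') := by
          have hk := mul_le_mul_of_nonneg_left key hr.le
          nlinarith
        nlinarith
      rw [es]; linarith
    · have : Y * (-s') ≤ 2 * r := by nlinarith [hp.le_rho]
      rw [es]; linarith
  · rcases hA with ⟨rfl, ha⟩ | ⟨rfl, ha⟩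
    · left; rw [es]; nlinarith
    · right
      have hYr := h.quotient_le_of_odd ha hp'.nonneg hY e
      refine ⟨hYr, ?_⟩
      have : Y * s' ≤ r * ρ ^ 2 := by
        calc Y * s' ≤ Y * ρ ^ 2 := mul_le_mul_of_nonneg_left s'le hY.le
          _ ≤ r * ρ ^ 2 := mul_le_mul_of_nonneg_right hYr (sq_nonneg _)
      rw [es]; linarith

end Heads

/-! ### Vertices of a normalised cell -/

/-- The products at the four vertices of a divided cell are at least `K (1 + XY)`. -/
structure CellBounds (K X Y s t : ℝ) : Prop where
  fst_nonneg : 0 ≤ 1 - Y + s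
  snd_nonneg : 0 ≤ 1 - Y - s
  third_nonneg : 0 ≤ 1 - X - t
  fourth_nonneg : 0 ≤ 1 - X + t
  fst : K * (1 + X * Y) ≤ (1 - Y + s) * (1 + X - t)
  snd : K * (1 + X * Y) ≤ (1 - Y - s) * (1 + X + t)
  third : K * (1 + X * Y) ≤ (1 + Y - s) * (1 - X - t)
  fourth : K * (1 + X * Y) ≤ (1 + Y + s) * (1 - X + t)

/-- The first vertex gives the constant its shape. After an odd head digit, 1 - 2r multiplies the
`kappa` bound, using Y ≤ r. After an even one, 1 + X - t ≥ (1 - r)(1 + X) suffices because (1 - ρ)(1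
- r) = 1 - 2r. The third vertex rests on X + t ≤ θ + τ and `bound_le`. -/
theorem Params.cellBounds {N θ τ r ρ X Y s t : ℝ} (h : Params N θ τ r ρ)
    (hX : TailBounds N θ τ r ρ X t) (hY : HeadBounds N r ρ Y s) :
    CellBounds ((1 - 2 * r) * (1 - 2 * θ ^ 2 - θ ^ 3)) X Y s t := by
  have hρ := h.rho_pos
  have hρ' := h.rho_le
  have hr := h.r_pos
  have hr' := h.r_le
  have hK := h.bound_le
  have hK0 := h.bound_pos
  have hK1 := h.bound_le_one_sub
  obtain ⟨κ0, κ1⟩ := h.kappa_bounds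
  have hfac := h.one_sub_two_r
  set κ := 1 - 2 * θ ^ 2 - θ ^ 3
  set K := (1 - 2 * r) * κ
  obtain ⟨X0, Xρ, t0, tr, tκ, tX⟩ := hX
  obtain ⟨⟨Y0, Yρ, sρ, sY⟩, hup, hlo, hout⟩ := hY
  have XY : X * Y ≤ X := mul_le_of_le_one_right X0.le (by linarith)
  have XY' : X * Y ≤ ρ * Y := mul_le_mul_of_nonneg_right Xρ Y0
  have XY0 : 0 ≤ X * Y := mul_nonneg X0.le Y0
  have inner : K * (1 + X * Y) ≤ (1 - 2 * r) * (1 + X) :=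
    mul_le_mul hK1 (by linarith) (by linarith) (by linarith)
  refine ⟨?_, by linarith, by linarith, by linarith, ?_, ?_, ?_, ?_⟩
  · rcases hup with ⟨_, hu⟩ | hu <;> linarith
  · rcases hup with ⟨hYr, hu⟩ | hu
    · have a1 : κ * (1 + X * Y) ≤ 1 + X - t :=
        le_trans (mul_le_mul_of_nonneg_left (by nlinarith) κ0.le) tκ
      calc K * (1 + X * Y) = (1 - 2 * r) * (κ * (1 + X * Y)) := mul_assoc _ _ _
        _ ≤ (1 - Y + s) * (1 + X - t) :=
          mul_le_mul hu a1 (mul_nonneg κ0.le (by linarith)) (by linarith)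
    · refine inner.trans ?_
      rw [hfac, mul_assoc]
      exact mul_le_mul hu (by linarith) (mul_nonneg (by linarith) (by linarith)) (by linarith)
  · exact inner.trans (mul_le_mul hlo (by linarith) (by linarith) (by linarith))
  · rw [mul_comm K]
    exact mul_le_mul (by nlinarith) (by linarith) hK0.le (by nlinarith)
  · rcases hout with hs | ⟨hYr, hs⟩
    · rw [mul_comm K]
      refine mul_le_mul (by nlinarith) ?_ hK0.le (by nlinarith)
      have := h.rho_le_two_r
      linarith
    · have b1 : (1 - r * ρ ^ 2) * (1 - ρ) ≤ (1 + Y + s) * (1 - X + t) :=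
        mul_le_mul (by linarith) (by linarith) (by linarith) (by nlinarith [mul_pos hr hρ])
      refine le_trans ?_ b1
      have b2 : X * Y ≤ r * ρ := by
        rw [mul_comm]; exact mul_le_mul hYr Xρ X0.le hr.le
      have b3 : K * (1 + X * Y) ≤ (1 - ρ) * (1 - r) * (1 + r * ρ) := by
        rw [← hfac]; exact mul_le_mul hK1 (by linarith) (by linarith) (by linarith)
      have b4 : (1 - r) * (1 + r * ρ) ≤ 1 - r * ρ ^ 2 := by
        have : 0 ≤ r * (1 - ρ - ρ ^ 2 + r * ρ) :=
          mul_nonneg hr.le (by nlinarith [mul_pos hr hρ])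
        nlinarith
      have := mul_le_mul_of_nonneg_left b4 (by linarith : 0 ≤ 1 - ρ)
      linarith

/-! ### From the continued fraction to cell bounds -/

/-- The normalised tail `∑_{i > k} λ'_i D_{i-1} / D_{k-1}`. -/
def tailRatio (α : ℝ) (k : ℕ) : ℝ := oddTail α k / dd α k

/-- The ratio `q_{k-1} / q_k`. -/
def denRatio (α : ℝ) (k : ℕ) : ℝ := den α k / den α (k + 1)

/-- The normalised head of the alternating sum of the `λ'_i q_{i-1}`. -/
def shiftRatio (α : ℝ) (k : ℕ) : ℝ := oddShift α k / den α (k + 1)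

section Recurrences

variable {α : ℝ} (hα : Irrational α)
include hα

theorem tailRatio_rec (k : ℕ) :
    tailRatio α k = fr α k * (lam α (k + 1) + tailRatio α (k + 1)) := by
  have h1 := (dd_pos hα k).ne'
  have h2 := (fr_pos hα k).ne'
  rw [tailRatio, tailRatio, oddTail_rec hα k, dd]
  field_simp

theorem denRatio_rec (k : ℕ) :
    denRatio α (k + 1) * (partQuot α (k + 1) + denRatio α k) = 1 := by
  have h1 := (den_pos hα k).2.ne'
  have h2 := (den_pos hα (k + 1)).2.ne'
  rw [denRatio, denRatio]
  field_simp
  rw [den]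
  ring

theorem shiftRatio_rec (k : ℕ) :
    shiftRatio α (k + 1) = -denRatio α (k + 1) * (lam α (k + 1) + shiftRatio α k) := by
  have h1 := (den_pos hα k).2.ne'
  have h2 := (den_pos hα (k + 1)).2.ne'
  rw [denRatio, shiftRatio, shiftRatio, oddShift]
  field_simp
  ring

theorem denRatio_nonneg (k : ℕ) : 0 ≤ denRatio α k :=
  div_nonneg (den_pos hα k).1 (den_pos hα k).2.le

theorem tailRatio_nonneg (k : ℕ) : 0 ≤ tailRatio α k :=
  div_nonneg (oddTail_nonneg hα k) (dd_pos hα k).le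

theorem tailRatio_le_two (k : ℕ) : tailRatio α k ≤ 2 := by
  rw [tailRatio, div_le_iff₀ (dd_pos hα k)]
  have h := oddTail_le hα k
  have : dd α (k + 1) ≤ dd α k :=
    mul_le_of_le_one_left (dd_pos hα k).le (fr_lt_one α k).le
  linarith

variable {N θ τ r ρ : ℝ} (hP : Params N θ τ r ρ) {k₀ : ℕ}
  (hA : ∀ k, k₀ ≤ k → Admissible N (partQuot α (k + 1)) (lam α (k + 1)))
include hP hA

/-- The crude bound 2 for every tail starts the induction, and each further digit halves the excess
by `tail_halve`. -/
theorem tailRatio_le_pow (j k : ℕ) (hk : k₀ ≤ k) :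
    tailRatio α k ≤ τ + 2 * (1 / 2) ^ j ∧
      tailRatio α k ≤ (1 + τ + 2 * (1 / 2) ^ j) * fr α k := by
  have first : ∀ k, k₀ ≤ k → tailRatio α k ≤ τ + 2 * (1 / 2) ^ j := by
    induction j with
    | zero => intro k _; linarith [tailRatio_le_two hα k, hP.tau_pos, pow_zero (1 / 2 : ℝ)]
    | succ j ih =>
      intro k hk
      have h1 := ih (k + 1) (by omega)
      have h2 := Params.tail_le_mul (hA (k + 1) (by omega)) (fr_pos hα (k + 1))
        (tailRatio_rec hα (k + 1)) (ih (k + 2) (by omega))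
      have := hP.tail_halve (hA k hk) (fr_pos hα (k + 1)) (fr_pos hα k) (fr_mul hα k)
        (tailRatio_rec hα k) (by positivity) h1 h2
      rw [pow_succ]
      linarith
  exact ⟨first k hk, Params.tail_le_mul (hA k hk) (fr_pos hα k) (tailRatio_rec hα k)
    (first (k + 1) (by omega))⟩

theorem tailRatio_le (k : ℕ) (hk : k₀ ≤ k) :
    tailRatio α k ≤ τ ∧ tailRatio α k ≤ (1 + τ) * fr α k := by
  have h0 : Tendsto (fun j : ℕ => 2 * (1 / 2 : ℝ) ^ j) atTop (nhds 0) := by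
    simpa using (tendsto_pow_atTop_nhds_zero_of_lt_one (r := (1 / 2 : ℝ))
      (by norm_num) (by norm_num)).const_mul 2
  constructor
  · refine ge_of_tendsto' (by simpa using h0.const_add τ) fun j =>
      (tailRatio_le_pow hα hP hA j k hk).1
  · refine ge_of_tendsto' (by simpa using (h0.const_add (1 + τ)).mul_const (fr α k)) fun j =>
      (tailRatio_le_pow hα hP hA j k hk).2

theorem tailBounds_tailRatio (k : ℕ) (hk : k₀ ≤ k) :
    TailBounds N θ τ r ρ (fr α k) (tailRatio α k) := by
  have h := tailRatio_le hα hP hA (k + 1) (by omega)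
  exact hP.tailBounds (hA k hk) (fr_pos hα _) (fr_pos hα _) (fr_mul hα k) (tailRatio_rec hα k)
    (tailRatio_nonneg hα _) h.1 h.2

theorem abs_shiftRatio_le_pow (j : ℕ) :
    |shiftRatio α (k₀ + j)| ≤ 2 / 3 + |shiftRatio α k₀| * (1 / 2) ^ j := by
  induction j with
  | zero => rw [pow_zero]; simp only [add_zero]; linarith
  | succ j ih =>
    have := hP.abs_head_le (hA (k₀ + j) (by omega)) (denRatio_nonneg hα _) (denRatio_rec hα _)
      (shiftRatio_rec hα _) (by positivity) ih
    rw [pow_succ, ← add_assoc]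
    linarith

theorem exists_headBounds :
    ∃ k₁, k₀ ≤ k₁ ∧ ∀ k, k₁ ≤ k → HeadBounds N r ρ (denRatio α k) (shiftRatio α k) := by
  have h0 : Tendsto (fun j : ℕ => |shiftRatio α k₀| * (1 / 2 : ℝ) ^ j) atTop (nhds 0) := by
    simpa using (tendsto_pow_atTop_nhds_zero_of_lt_one (r := (1 / 2 : ℝ))
      (by norm_num) (by norm_num)).const_mul |shiftRatio α k₀|
  obtain ⟨j₀, hj₀⟩ := eventually_atTop.1 (h0.eventually_le_const (show (0 : ℝ) < 1 / 3 by norm_num))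
  have one : ∀ k, k₀ + j₀ ≤ k → |shiftRatio α k| ≤ 1 := fun k hk => by
    have h1 := abs_shiftRatio_le_pow hα hP hA (k - k₀)
    rw [Nat.add_sub_cancel' (by omega : k₀ ≤ k)] at h1
    linarith [hj₀ (k - k₀) (by omega)]
  have le : ∀ k, k₀ + j₀ ≤ k → shiftRatio α (k + 1) ≤ ρ := fun k hk =>
    hP.head_le (hA k (by omega)) (denRatio_nonneg hα k) (denRatio_rec hα k)
      (shiftRatio_rec hα k) (one k hk)
  have ge : ∀ k, k₀ + j₀ ≤ k → -ρ ≤ shiftRatio α (k + 2) := fun k hk =>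
    hP.neg_le_head (hA (k + 1) (by omega)) (denRatio_nonneg hα _) (denRatio_rec hα _)
      (shiftRatio_rec hα _) (le k hk)
  have pre : ∀ k, k₀ + j₀ ≤ k → HeadPre N ρ (denRatio α (k + 3)) (shiftRatio α (k + 3)) :=
    fun k hk => hP.headPre (hA (k + 2) (by omega)) (denRatio_nonneg hα _) (denRatio_rec hα _)
      (shiftRatio_rec hα _) (ge k hk) (le (k + 1) (by omega))
  -- From |s| ≤ 1, one digit each gives s ≤ ρ, then s ≥ -ρ, then `HeadPre`; `headBounds` consumes
  -- two more.
  refine ⟨k₀ + j₀ + 5, by omega, fun k hk => ?_⟩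
  obtain ⟨i, rfl⟩ : ∃ i, k = i + 5 := ⟨k - 5, by omega⟩
  exact hP.headBounds (hA (i + 3) (by omega)) (hA (i + 4) (by omega)) (pre i (by omega))
    (denRatio_rec hα _) (shiftRatio_rec hα _) (denRatio_rec hα _) (shiftRatio_rec hα _)

end Recurrences

/-- Bounds at the vertices of a divided cell, for half-sides `(q, -q')`, `(d, d')` and
centre `(w, -T)`. -/
structure CellData (K q q' d d' w T : ℝ) : Prop where
  abs_le : |w| ≤ q / 2
  fst_nonneg : 0 ≤ q - q' + w
  snd_nonneg : 0 ≤ q - q' - w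
  third_nonneg : 0 ≤ d - d' - T
  fourth_nonneg : 0 ≤ d - d' + T
  fst : K ≤ (q - q' + w) * (d + d' - T)
  snd : K ≤ (q - q' - w) * (d + d' + T)
  third : K ≤ (q + q' - w) * (d - d' - T)
  fourth : K ≤ (q + q' + w) * (d - d' + T)

theorem exists_cellData {α : ℝ} (hα : Irrational α) {N θ τ r ρ : ℝ} (hP : Params N θ τ r ρ)
    {k₀ : ℕ} (hA : ∀ k, k₀ ≤ k → Admissible N (partQuot α (k + 1)) (lam α (k + 1))) :
    ∃ k₁, ∀ k, k₁ ≤ k → CellData ((1 - 2 * r) * (1 - 2 * θ ^ 2 - θ ^ 3)) (den α (k + 1))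
      (den α k) (dd α k) (dd α (k + 1)) (oddShift α k) (oddTail α k) := by
  obtain ⟨k₁, hk₁, hH⟩ := exists_headBounds hα hP hA
  refine ⟨k₁, fun k hk => ?_⟩
  have hY := hH k hk
  have hc := hP.cellBounds (tailBounds_tailRatio hα hP hA k (by omega)) hY
  have hq := (den_pos hα k).2
  have hd := dd_pos hα k
  have eX : dd α (k + 1) = dd α k * fr α k := by rw [dd, mul_comm]
  have et : oddTail α k = dd α k * tailRatio α k := by rw [tailRatio]; field_simp
  have eY : den α k = den α (k + 1) * denRatio α k := by rw [denRatio]; field_simp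
  have es : oddShift α k = den α (k + 1) * shiftRatio α k := by rw [shiftRatio]; field_simp
  have e1 := den_mul_dd hα k
  rw [eX, eY] at e1
  rw [eX, et, es]
  have hs1 := hY.neg_rho_le
  have hs2 : shiftRatio α k ≤ ρ := by
    have := hY.le_mul; have := hY.le_rho; have := hP.rho_le; have := hP.rho_pos; nlinarith
  have hρ := hP.rho_le
  generalize (1 - 2 * r) * (1 - 2 * θ ^ 2 - θ ^ 3) = K at hc ⊢
  rw [eY]
  generalize den α (k + 1) = q at *
  generalize dd α k = d at *
  generalize fr α k = X at *
  generalize denRatio α k = Y at *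
  generalize shiftRatio α k = s at *
  generalize tailRatio α k = t at *
  have hqd := mul_pos hq hd
  -- Since qd(1 + XY) = 1, the factor 1 + XY in the normalised bounds disappears on rescaling.
  have lift : ∀ u v, K * (1 + X * Y) ≤ u * v → K ≤ q * u * (d * v) := fun u v h => by
    have := mul_le_mul_of_nonneg_left h hqd.le
    calc K = q * d * (K * (1 + X * Y)) := by linear_combination (-K) * e1
      _ ≤ q * d * (u * v) := this
      _ = q * u * (d * v) := by ring
  refine ⟨?_, ?_, ?_, ?_, ?_, ?_, ?_, ?_, ?_⟩
  · rw [abs_mul, abs_of_pos hq]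
    have : |s| ≤ 1 / 2 := abs_le.2 ⟨by linarith, by linarith⟩
    nlinarith
  · have := mul_nonneg hq.le hc.fst_nonneg; linarith
  · have := mul_nonneg hq.le hc.snd_nonneg; linarith
  · have := mul_nonneg hd.le hc.third_nonneg; linarith
  · have := mul_nonneg hd.le hc.fourth_nonneg; linarith
  · convert lift _ _ hc.fst using 1; ring
  · convert lift _ _ hc.snd using 1; ring
  · convert lift _ _ hc.third using 1; ring
  · convert lift _ _ hc.fourth using 1; ring

/-! ### Reduction of grid points to vertices -/

/-- A concave quadratic on an interval is at least its minimum at the end points. -/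
theorem le_mul_of_le_ends {K b c e x p z : ℝ} (hx : 0 ≤ x) (h1 : p ≤ z) (h2 : z ≤ b)
    (hp : K ≤ (p + c) * (e - p * x)) (hb : K ≤ (b + c) * (e - b * x)) :
    K ≤ (z + c) * (e - z * x) := by
  rcases le_total 0 (e - x * (z + p + c)) with h | h
  · nlinarith [mul_nonneg (sub_nonneg.2 h1) h]
  · have : e - x * (z + b + c) ≤ 0 := by nlinarith
    nlinarith [mul_nonneg (sub_nonneg.2 h2) (neg_nonneg.2 this)]

/-- Grid points between two consecutive divided cells are dominated by their vertices. -/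
theorem le_mul_of_transition {K q q' d d' q₂ d₂ w T w₂ T₂ a l U W : ℝ}
    (hq : 0 ≤ q) (hq' : 0 ≤ q') (hq₂ : 0 ≤ q₂) (hd : 0 ≤ d) (hd' : 0 ≤ d') (hd₂ : 0 ≤ d₂)
    (eq : q₂ = a * q + q') (ed : d = a * d' + d₂) (ew : w₂ = -w - l * q)
    (eT : T = l * d' + T₂) (hU : 1 ≤ U) (hW : 1 ≤ W) (hUW : 1 ≤ a * U - W - l)
    (h1 : 0 ≤ q + q' - w) (h2 : 0 ≤ d - d' - T) (h3 : K ≤ (q + q' - w) * (d - d' - T))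
    (h4 : 0 ≤ q₂ - q + w₂) (h5 : 0 ≤ d' + d₂ - T₂) (h6 : K ≤ (q₂ - q + w₂) * (d' + d₂ - T₂)) :
    K ≤ (W * q + U * q' - w) * (U * d - W * d' - T) := by
  rcases hq.eq_or_lt with rfl | hqpos
  · have e1 : q' ≤ U * q' := le_mul_of_one_le_left hq' hU
    have e2 : d' + d₂ - T₂ ≤ U * d - W * d' - T := by
      subst ed eT; nlinarith [mul_nonneg (sub_nonneg.2 hU) hd₂]
    refine h6.trans ?_
    have : q₂ - 0 + w₂ ≤ W * 0 + U * q' - w := by rw [eq, ew]; linarith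
    exact mul_le_mul this e2 h5 (h4.trans this)
  -- The variable is z = Wq. The ends are W = 1 and W = aU - l - 1, where the first coordinate in
  -- the next cell is 1; they are compared with a vertex of the old and of the new cell.
  have key := le_mul_of_le_ends (K := K) (b := (a * U - l - 1) * q) (c := U * q' - w)
    (e := U * d - T) (x := d' / q) (p := q) (z := W * q) (by positivity)
    (le_mul_of_one_le_left hq hW) (mul_le_mul_of_nonneg_right (by linarith) hq) ?_ ?_
  · convert key using 1
    field_simp
    ring
  · refine h3.trans ?_
    have e1 : q + q' - w ≤ q + (U * q' - w) := by nlinarith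
    have e2 : d - d' - T ≤ U * d - T - q * (d' / q) := by
      have : q * (d' / q) = d' := by field_simp
      rw [this]; nlinarith
    exact mul_le_mul e1 e2 h2 (h1.trans e1)
  · refine h6.trans ?_
    have e1 : q₂ - q + w₂ ≤ (a * U - l - 1) * q + (U * q' - w) := by
      have : (a * U - l - 1) * q + (U * q' - w) = U * q₂ - q + w₂ := by rw [eq, ew]; ring
      rw [this]; nlinarith
    have e2 : d' + d₂ - T₂ ≤ U * d - T - (a * U - l - 1) * q * (d' / q) := by
      have : U * d - T - (a * U - l - 1) * q * (d' / q) = d' + U * d₂ - T₂ := by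
        rw [ed, eT]; field_simp; ring
      rw [this]; nlinarith
    exact mul_le_mul e1 e2 h5 (h4.trans e1)

/-! ### The grid and its changes of basis -/

/-- Coordinates of a grid point with respect to the successive divided cells. -/
def coords (α : ℝ) (p : ℤ × ℤ) : ℕ → ℤ × ℤ
  | 0 => p
  | k + 1 => ((coords α p k).2 + partQuot α (k + 1) * (coords α p k).1 - partQuot α (k + 1) % 2,
      (coords α p k).1)

theorem lam_eq_emod (α : ℝ) (k : ℕ) : lam α k = ((partQuot α k % 2 : ℤ) : ℝ) := by
  rcases lam_eq α k with ⟨h, h'⟩ | ⟨h, h'⟩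
  · rw [h, Int.even_iff.1 h']; simp
  · rw [h, Int.odd_iff.1 h']; simp

/-- Modulo 2 the new coordinate is 1 + a - (a mod 2), hence odd. -/
theorem odd_coords {α : ℝ} {p : ℤ × ℤ} (h1 : Odd p.1) (h2 : Odd p.2) (k : ℕ) :
    Odd (coords α p k).1 ∧ Odd (coords α p k).2 := by
  induction k with
  | zero => exact ⟨h1, h2⟩
  | succ k ih =>
    refine ⟨?_, ih.1⟩
    obtain ⟨⟨u, hu⟩, ⟨v, hv⟩⟩ := ih
    simp only [coords]
    rw [hu, hv]
    obtain ⟨b, hb⟩ : ∃ b, partQuot α (k + 1) = 2 * b + partQuot α (k + 1) % 2 :=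
      ⟨partQuot α (k + 1) / 2, by omega⟩
    refine ⟨v + partQuot α (k + 1) * u + b, ?_⟩
    linear_combination hb

/-- First coordinate of the grid point `(U, V)` of the `k`-th cell. -/
def gridX (α : ℝ) (k : ℕ) (c : ℤ × ℤ) : ℝ :=
  c.2 * den α (k + 1) - c.1 * den α k + oddShift α k

/-- Second coordinate of the grid point `(U, V)` of the `k`-th cell. -/
def gridY (α : ℝ) (k : ℕ) (c : ℤ × ℤ) : ℝ :=
  c.1 * dd α k + c.2 * dd α (k + 1) - oddTail α k

/-- Each change of basis reverses the sign of the first coordinate and, as the next lemma shows,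
fixes the second. -/
theorem abs_gridX_coords (α : ℝ) (p : ℤ × ℤ) (k : ℕ) :
    |gridX α k (coords α p k)| = |gridX α 0 p| := by
  induction k with
  | zero => rfl
  | succ k ih =>
    rw [← ih, ← abs_neg (gridX α k _)]
    congr 1
    simp only [gridX, coords, oddShift, den]
    push_cast [lam_eq_emod]
    ring

theorem gridY_coords {α : ℝ} (hα : Irrational α) (p : ℤ × ℤ) (k : ℕ) :
    gridY α k (coords α p k) = gridY α 0 p := by
  induction k with
  | zero => rfl
  | succ k ih =>
    rw [← ih]
    simp only [gridY, coords]
    rw [oddTail_rec hα k, dd_rec hα k]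
    push_cast [lam_eq_emod]
    ring

/-- The coordinates of the grid point belonging to `n α - m - γ_**`. -/
def startCoords (α : ℝ) (n m : ℤ) : ℤ × ℤ :=
  (2 * n * partQuot α 0 - 2 * m - 1, 2 * n - 1)

theorem gridX_startCoords (α : ℝ) (n m : ℤ) : gridX α 0 (startCoords α n m) = 2 * n := by
  simp [gridX, startCoords, den, oddShift]

theorem gridY_startCoords {α : ℝ} (hα : Irrational α) (n m : ℤ) :
    gridY α 0 (startCoords α n m) = 2 * (n * α - gammaStarStar α - m) := by
  rw [gammaStarStar, (hasSum_gammaTerm hα).tsum_eq]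
  have : α = partQuot α 0 + fr α 0 := by rw [partQuot_zero, fr, Int.floor_add_fract]
  simp only [gridY, startCoords, dd]
  push_cast
  linear_combination (-2 * (n : ℝ)) * this

theorem odd_startCoords (α : ℝ) (n m : ℤ) :
    Odd (startCoords α n m).1 ∧ Odd (startCoords α n m).2 :=
  ⟨⟨n * partQuot α 0 - m - 1, by simp only [startCoords]; ring⟩,
    ⟨n - 1, by simp only [startCoords]; ring⟩⟩

theorem abs_gridY_ge {α : ℝ} (hα : Irrational α) {k : ℕ} {c : ℤ × ℤ} (hc : 0 < c.1 * c.2) :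
    |(c.1 : ℝ)| * dd α k + |(c.2 : ℝ)| * dd α (k + 1) ≤ |gridY α k c| + oddTail α k := by
  have hT := oddTail_nonneg hα k
  rw [gridY]
  rcases mul_pos_iff.1 hc with ⟨h1, h2⟩ | ⟨h1, h2⟩
  · have h1' : (0 : ℝ) < c.1 := by exact_mod_cast h1
    have h2' : (0 : ℝ) < c.2 := by exact_mod_cast h2
    rw [abs_of_pos h1', abs_of_pos h2']
    linarith [le_abs_self (c.1 * dd α k + c.2 * dd α (k + 1) - oddTail α k)]
  · have h1' : (c.1 : ℝ) < 0 := by exact_mod_cast h1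
    have h2' : (c.2 : ℝ) < 0 := by exact_mod_cast h2
    rw [abs_of_neg h1', abs_of_neg h2']
    linarith [neg_abs_le (c.1 * dd α k + c.2 * dd α (k + 1) - oddTail α k)]

/-! ### Lower bound for M from the cells -/

section Cells

variable {α K : ℝ} (hα : Irrational α) {k₁ : ℕ}
  (hC : ∀ k, k₁ ≤ k → CellData K (den α (k + 1)) (den α k) (dd α k) (dd α (k + 1))
    (oddShift α k) (oddTail α k))
include hα hC

/-- For UV < 0 the terms Vq and -Uq' have no opposite signs, and the shift w costs at most q / 2. -/
theorem den_le_abs_gridX {k : ℕ} (hk : k₁ ≤ k) {c : ℤ × ℤ} (hc : c.1 * c.2 < 0) :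
    den α (k + 1) ≤ 2 * |gridX α k c| := by
  have hq := (den_pos hα k).2
  have hq' := (den_pos hα k).1
  obtain ⟨hw1, hw2⟩ := abs_le.1 (hC k hk).abs_le
  rw [gridX]
  rcases mul_neg_iff.1 hc with ⟨h1, h2⟩ | ⟨h1, h2⟩
  · have h1' : (0 : ℝ) ≤ c.1 := by exact_mod_cast h1.le
    have h2' : (c.2 : ℝ) ≤ -1 := by exact_mod_cast (by omega : c.2 ≤ -1)
    have := neg_abs_le (c.2 * den α (k + 1) - c.1 * den α k + oddShift α k)
    nlinarith [mul_nonneg h1' hq']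
  · have h1' : (c.1 : ℝ) ≤ 0 := by exact_mod_cast h1.le
    have h2' : (1 : ℝ) ≤ c.2 := by exact_mod_cast (by omega : 1 ≤ c.2)
    have := le_abs_self (c.2 * den α (k + 1) - c.1 * den α k + oddShift α k)
    nlinarith [mul_nonneg (neg_nonneg.2 h1') hq']

theorem exists_coords_mul_nonneg (p : ℤ × ℤ) :
    ∃ k, k₁ ≤ k ∧ 0 ≤ (coords α p k).1 * (coords α p k).2 := by
  by_contra! hneg
  obtain ⟨j, hj⟩ := exists_nat_gt (2 * |gridX α 0 p| + 1)
  have h1 := den_le_abs_gridX hα hC (Nat.le_add_right k₁ j) (hneg _ (Nat.le_add_right k₁ j))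
  rw [abs_gridX_coords] at h1
  have h2 := le_den hα (k₁ + j)
  push_cast at h2
  linarith [Nat.cast_nonneg (α := ℝ) k₁]

theorem le_abs_gridX_mul_gridY {k : ℕ} (hk : k₁ ≤ k) (p : ℤ × ℤ)
    (h1 : (coords α p k).1 * (coords α p k).2 < 0)
    (h2 : 0 < (coords α p (k + 1)).1 * (coords α p (k + 1)).2) :
    K ≤ |gridX α k (coords α p k)| * |gridY α k (coords α p k)| := by
  have hC1 := hC k hk
  have hC2 := hC (k + 1) (by omega)
  have hq := (den_pos hα k).2.le
  have hq' := (den_pos hα k).1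
  have hq₂ := (den_pos hα (k + 1)).2.le
  have hd := (dd_pos hα k).le
  have hd' := (dd_pos hα (k + 1)).le
  have hd₂ := (dd_pos hα (k + 2)).le
  obtain ⟨hw1, hw2⟩ := abs_le.1 hC1.abs_le
  have eq : den α (k + 2) = partQuot α (k + 1) * den α (k + 1) + den α k := by rw [den]
  have ed := dd_rec hα k
  have ew : oddShift α (k + 1) = -oddShift α k - lam α (k + 1) * den α (k + 1) := rfl
  have eT := oddTail_rec hα k
  simp only [coords] at h2
  rw [← abs_mul, gridX, gridY]
  set c := coords α p k
  rcases mul_neg_iff.1 h1 with ⟨hu, hv⟩ | ⟨hu, hv⟩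
  · have hUi : 1 ≤ c.1 := hu
    have hWi : 1 ≤ -c.2 := by omega
    have hUWi : 1 ≤ partQuot α (k + 1) * c.1 - -c.2 - partQuot α (k + 1) % 2 := by
      have := pos_of_mul_pos_left h2 hu.le
      omega
    have hU : (1 : ℝ) ≤ c.1 := by exact_mod_cast hUi
    have hW : (1 : ℝ) ≤ -c.2 := by exact_mod_cast hWi
    have hUW : (1 : ℝ) ≤ partQuot α (k + 1) * c.1 - -c.2 - lam α (k + 1) := by
      rw [lam_eq_emod]; exact_mod_cast hUWi
    have := le_mul_of_transition hq hq' hq₂ hd hd' hd₂ eq ed ew eT hU hW hUW (by linarith)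
      hC1.third_nonneg hC1.third hC2.fst_nonneg
      (by linarith [hC2.third_nonneg]) hC2.fst
    refine this.trans ((le_of_eq ?_).trans (neg_le_abs _))
    ring
  -- The opposite sign pattern is the reflected case: w, T and λ' are negated, and the fourth and
  -- second vertices replace the third and first.
  · have hUi : 1 ≤ -c.1 := by omega
    have hWi : 1 ≤ c.2 := hv
    have hUWi : 1 ≤ partQuot α (k + 1) * -c.1 - c.2 - -(partQuot α (k + 1) % 2) := by
      have := neg_of_mul_pos_left h2 hu.le
      linarith [Int.add_one_le_iff.2 this]
    have hU : (1 : ℝ) ≤ -c.1 := by exact_mod_cast hUi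
    have hW : (1 : ℝ) ≤ c.2 := by exact_mod_cast hWi
    have hUW : (1 : ℝ) ≤ partQuot α (k + 1) * -c.1 - c.2 - -lam α (k + 1) := by
      rw [lam_eq_emod]; exact_mod_cast hUWi
    have := le_mul_of_transition (K := K) (w := -oddShift α k) (T := -oddTail α k)
      (w₂ := -oddShift α (k + 1)) (T₂ := -oddTail α (k + 1)) hq hq' hq₂ hd hd' hd₂ eq ed
      (by rw [ew]; ring) (by rw [eT]; ring) hU hW hUW (by linarith)
      (by linarith [hC1.fourth_nonneg]) (by linarith [hC1.fourth])
      (by linarith [hC2.snd_nonneg]) (by linarith [hC2.fourth_nonneg])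
      (by linarith [hC2.snd])
    refine this.trans ((le_of_eq ?_).trans (neg_le_abs _))
    ring

theorem exists_forall_le_abs_mul :
    ∃ B : ℝ, ∀ n m : ℤ, B < |(n : ℝ)| → |n * α - gammaStarStar α - m| ≤ 1 →
      K / 4 ≤ |(n : ℝ)| * |n * α - gammaStarStar α - m| := by
  have hd := dd_pos hα k₁
  have hd' := dd_pos hα (k₁ + 1)
  have hq := (den_pos hα k₁).2
  have hq' := (den_pos hα k₁).1
  -- If UV > 0 in cell k₁, then |y| ≤ 2 bounds U and V, hence |x| = 2|n|; this determines B.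
  set C := 2 + oddTail α k₁ with hCdef
  set B := C / dd α (k₁ + 1) * den α (k₁ + 1) + C / dd α k₁ * den α k₁ + |oddShift α k₁| with hB
  refine ⟨B, fun n m hn hm => ?_⟩
  set p := startCoords α n m
  have hX : ∀ k, |gridX α k (coords α p k)| = 2 * |(n : ℝ)| := fun k => by
    rw [abs_gridX_coords, gridX_startCoords, abs_mul, abs_two]
  have hY : ∀ k, |gridY α k (coords α p k)| = 2 * |n * α - gammaStarStar α - m| := fun k => by
    rw [gridY_coords hα, gridY_startCoords hα, abs_mul, abs_two]
  have hne : ∀ k, (coords α p k).1 * (coords α p k).2 ≠ 0 := fun k => by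
    obtain ⟨h1, h2⟩ := odd_coords (α := α) (odd_startCoords α n m).1 (odd_startCoords α n m).2 k
    have := h1.mul h2
    intro h0
    rw [h0] at this
    exact absurd this (by decide)
  have hstart : (coords α p k₁).1 * (coords α p k₁).2 < 0 := by
    by_contra hc
    have hpos := lt_of_le_of_ne (not_lt.1 hc) (hne k₁).symm
    have h1 := abs_gridY_ge hα (k := k₁) hpos
    rw [hY] at h1
    have h2 := hX k₁
    have hu : |((coords α p k₁).1 : ℝ)| ≤ C / dd α k₁ := by
      rw [le_div_iff₀ hd]
      linarith [mul_nonneg (abs_nonneg ((coords α p k₁).2 : ℝ)) hd'.le]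
    have hv : |((coords α p k₁).2 : ℝ)| ≤ C / dd α (k₁ + 1) := by
      rw [le_div_iff₀ hd']
      linarith [mul_nonneg (abs_nonneg ((coords α p k₁).1 : ℝ)) hd.le]
    have h3 : |gridX α k₁ (coords α p k₁)| ≤ B := by
      rw [gridX]
      refine (abs_add_le _ _).trans (add_le_add_left ((abs_sub _ _).trans ?_) _)
      rw [abs_mul, abs_mul, abs_of_pos hq, abs_of_nonneg hq']
      exact add_le_add (mul_le_mul_of_nonneg_right hv hq.le)
        (mul_le_mul_of_nonneg_right hu hq')
    linarith [abs_nonneg (n : ℝ)]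
  obtain ⟨k, hk, hneg, hpos⟩ : ∃ k, k₁ ≤ k ∧ (coords α p k).1 * (coords α p k).2 < 0 ∧
      0 < (coords α p (k + 1)).1 * (coords α p (k + 1)).2 := by
    by_contra! hno
    obtain ⟨j, hj, hj0⟩ := exists_coords_mul_nonneg hα hC p
    have all : ∀ k, k₁ ≤ k → (coords α p k).1 * (coords α p k).2 < 0 := by
      intro k hk
      induction k, hk using Nat.le_induction with
      | base => exact hstart
      | succ k hk ih => exact lt_of_le_of_ne (hno k hk ih) (hne _)
    exact absurd (all j hj) (not_lt.2 hj0)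
  have := le_abs_gridX_mul_gridY hα hC hk p hneg hpos
  rw [hX, hY] at this
  linarith

/-- A representation of γ_** would give a grid point with y = 0. In some late cell it has UV > 0, so
the tail T is at least D_{k-1} + D_k, whereas the third vertex forces T ≤ D_{k-1} - D_k. -/
theorem gammaStarStar_ne (n m : ℤ) : gammaStarStar α ≠ (m : ℝ) + (n : ℝ) * α := by
  intro hγ
  have hY : ∀ k, gridY α k (coords α (startCoords α n (-m)) k) = 0 := fun k => by
    rw [gridY_coords hα, gridY_startCoords hα, hγ]; push_cast; ring
  obtain ⟨k, hk, h0⟩ := exists_coords_mul_nonneg hα hC (startCoords α n (-m))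
  obtain ⟨h1, h2⟩ := odd_coords (α := α) (odd_startCoords α n (-m)).1
    (odd_startCoords α n (-m)).2 k
  have hpos : 0 < (coords α (startCoords α n (-m)) k).1 *
      (coords α (startCoords α n (-m)) k).2 := by
    refine lt_of_le_of_ne h0 fun h => ?_
    have := h1.mul h2
    rw [← h] at this
    exact absurd this (by decide)
  have h3 := abs_gridY_ge hα (k := k) hpos
  rw [hY, abs_zero, zero_add] at h3
  have h4 := (hC k hk).third_nonneg
  have hd := dd_pos hα k
  have hd' := dd_pos hα (k + 1)
  have h5 : (1 : ℝ) ≤ |((coords α (startCoords α n (-m)) k).1 : ℝ)| := by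
    have : (coords α (startCoords α n (-m)) k).1 ≠ 0 := fun h => by
      rw [h] at h1; exact absurd h1 (by decide)
    exact_mod_cast Int.one_le_abs this
  nlinarith [mul_nonneg (abs_nonneg ((coords α (startCoords α n (-m)) k).2 : ℝ)) hd'.le]

theorem le_M_gammaStarStar : ((K / 4 : ℝ) : EReal) ≤ M α (gammaStarStar α) := by
  obtain ⟨B, hB⟩ := exists_forall_le_abs_mul hα hC
  refine le_liminf_of_le (by isBoundedDefault) ?_
  rw [← Int.cofinite_eq, eventually_cofinite]
  refine (Set.finite_Icc (-⌈B⌉) ⌈B⌉).subset fun n hn => ?_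
  by_contra hout
  refine hn (EReal.coe_le_coe_iff.2 ?_)
  refine hB n (round (n * α - gammaStarStar α)) ?_
    ((abs_sub_round _).trans (by norm_num))
  have h1 : ⌈B⌉ < |n| := by
    rw [← not_le, abs_le]; exact hout
  calc B ≤ ⌈B⌉ := Int.le_ceil B
    _ < |(n : ℝ)| := by exact_mod_cast h1

end Cells

/-! ### Explicit constants and conclusion -/

/-- The continued fraction `[0; N, N, …]`. -/
def periodicTheta (N : ℝ) : ℝ := (1 / 2) * (√(N ^ 2 + 4) - N)

theorem params_periodicTheta {N : ℝ} (hN : 3 ≤ N) :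
    Params N (periodicTheta N) (periodicTheta N / (1 - periodicTheta N)) (1 / N)
      (1 / (N - 1)) := by
  have hsq : √(N ^ 2 + 4) ^ 2 = N ^ 2 + 4 := Real.sq_sqrt (by positivity)
  have hpos : N < √(N ^ 2 + 4) := Real.lt_sqrt_of_sq_lt (by linarith)
  have hlt : √(N ^ 2 + 4) < N + 2 := by
    rw [Real.sqrt_lt' (by linarith)]; nlinarith
  refine ⟨hN, ?_, ?_, ?_, ?_, ?_⟩
  · rw [periodicTheta]; linarith
  · rw [periodicTheta]; linear_combination hsq / 4
  · have : 1 - periodicTheta N ≠ 0 := by rw [periodicTheta]; linarith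
    field_simp
  · field_simp
  · have : N - 1 ≠ 0 := by linarith
    field_simp

/-- The lower bound of the theorem as a function of `N = R_*`. -/
def lowerBound (N : ℝ) : ℝ :=
  (1 / 4) * (1 - 2 / N) * (1 - 2 * periodicTheta N ^ 2 - periodicTheta N ^ 3)

theorem polynomial_le_lowerBound {N : ℝ} (hN : 3 ≤ N) :
    (1 / 4) * (1 - 2 / N - 2 / N ^ 2 + 3 / N ^ 3) ≤ lowerBound N := by
  have hP := params_periodicTheta hN
  have h1 := hP.theta_le_r
  have h0 := hP.theta_pos
  have hr := hP.r_le
  rw [lowerBound, show 2 / N = 2 * (1 / N) by ring, show 2 / N ^ 2 = 2 * (1 / N) ^ 2 by ring,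
    show 3 / N ^ 3 = 3 * (1 / N) ^ 3 by ring]
  generalize 1 / N = r at *
  generalize periodicTheta N = θ at *
  have h2 : θ ^ 2 ≤ r ^ 2 := pow_le_pow_left₀ h0.le h1 2
  have h3 : θ ^ 3 ≤ r ^ 3 := pow_le_pow_left₀ h0.le h1 3
  -- At θ = r the product expands to 1 - 2r - 2r² + 3r³ + 2r⁴; the last term is dropped.
  have h4 : (1 - 2 * r) * (1 - 2 * r ^ 2 - r ^ 3) ≤ (1 - 2 * r) * (1 - 2 * θ ^ 2 - θ ^ 3) :=
    mul_le_mul_of_nonneg_left (by linarith) (by linarith)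
  nlinarith [sq_nonneg (r ^ 2)]

theorem lowerBound_three : lowerBound 3 = 1 / (2 * √13 + 8) := by
  have h : √13 ^ 2 = 13 := Real.sq_sqrt (by norm_num)
  have hpos : 0 ≤ √13 := Real.sqrt_nonneg _
  rw [lowerBound, periodicTheta, show (3 : ℝ) ^ 2 + 4 = 13 by norm_num, eq_div_iff (by positivity)]
  generalize √13 = x at *
  have h3 : x ^ 3 = 13 * x := by rw [pow_succ, h]
  have h4 : x ^ 4 = 169 := by rw [show x ^ 4 = (x ^ 2) ^ 2 by ring, h]; norm_num
  ring_nf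
  rw [h, h3, h4]
  ring

theorem exists_cellData_of_eventually {α : ℝ} (hα : Irrational α) {N : ℕ} (hN : 3 ≤ N)
    (hodd : Odd N) (h : ∀ᶠ i in atTop, (N : ℤ) - 1 ≤ partQuot α i) :
    ∃ k₁, ∀ k, k₁ ≤ k → CellData (4 * lowerBound N) (den α (k + 1))
      (den α k) (dd α k) (dd α (k + 1)) (oddShift α k) (oddTail α k) := by
  obtain ⟨k₀, hk₀⟩ := eventually_atTop.1 h
  have hP := params_periodicTheta (N := N) (by exact_mod_cast hN)
  have e : 4 * lowerBound N = (1 - 2 * (1 / (N : ℝ))) *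
      (1 - 2 * periodicTheta N ^ 2 - periodicTheta N ^ 3) := by rw [lowerBound]; ring
  rw [e]
  refine exists_cellData hα (k₀ := k₀) hP fun k hk => ?_
  have ha := hk₀ (k + 1) (by omega)
  rcases lam_eq α (k + 1) with ⟨hl, _⟩ | ⟨hl, ho⟩
  · exact Or.inl ⟨hl, by exact_mod_cast ha⟩
  · refine Or.inr ⟨hl, ?_⟩
    -- An odd digit cannot equal the even number N - 1.
    have : (N : ℤ) ≤ partQuot α (k + 1) := by
      obtain ⟨u, hu⟩ := hodd
      obtain ⟨v, hv⟩ := ho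
      omega
    exact_mod_cast this

theorem lowerBound_le_M {α : ℝ} (hα : Irrational α) {N : ℕ} (hN : 3 ≤ N)
    (hodd : Odd N) (h : ∀ᶠ i in atTop, (N : ℤ) - 1 ≤ partQuot α i) :
    ((lowerBound N : ℝ) : EReal) ≤ M α (gammaStarStar α) := by
  obtain ⟨k₁, hC⟩ := exists_cellData_of_eventually hα hN hodd h
  have := le_M_gammaStarStar hα hC
  rwa [mul_div_cancel_left₀ _ (by norm_num : (4 : ℝ) ≠ 0)] at this

theorem eventually_le_partQuot {α : ℝ} {b : ℕ} (h : (b : ℕ∞) < liminfPartQuot α) :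
    ∀ᶠ i in atTop, (b : ℤ) + 1 ≤ partQuot α i := by
  filter_upwards [eventually_lt_of_lt_liminf h] with i hi
  have : b < (partQuot α i).toNat := by exact_mod_cast hi
  omega

theorem lowerBound_Rstar_le_M {α : ℝ} (hα : Irrational α) {R : ℕ} (hR : 2 ≤ R)
    (h : liminfPartQuot α = R) :
    ((lowerBound (Rstar R) : ℝ) : EReal) ≤ M α (gammaStarStar α) := by
  have h1 : ((R - 1 : ℕ) : ℕ∞) < liminfPartQuot α := by
    rw [h]; exact_mod_cast (by omega : R - 1 < R)
  have hspec : Odd (Rstar R) ∧ Rstar R ≤ R + 1 ∧ 3 ≤ Rstar R := by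
    unfold Rstar
    split_ifs with ho
    · obtain ⟨u, hu⟩ := ho
      exact ⟨⟨u, hu⟩, by omega, by omega⟩
    · exact ⟨(Nat.not_odd_iff_even.1 ho).add_one, le_rfl, by omega⟩
  refine lowerBound_le_M hα hspec.2.2 hspec.1 ?_
  filter_upwards [eventually_le_partQuot h1] with i hi
  have := hspec.2.1
  omega

/-- The finite bound holds for every odd N = 2j + 3, and its polynomial minorant tends to 1/4. -/
theorem quarter_le_M {α : ℝ} (hα : Irrational α) (h : liminfPartQuot α = ⊤) :
    ((1 / 4 : ℝ) : EReal) ≤ M α (gammaStarStar α) := by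
  have hodd : Tendsto (fun j : ℕ => ((2 * j + 3 : ℕ) : ℝ)) atTop atTop :=
    tendsto_natCast_atTop_atTop.comp
      (tendsto_atTop_mono (fun j => by simp only [id]; omega) tendsto_id)
  have hlim : Tendsto (fun x : ℝ => (1 / 4) * (1 - 2 / x - 2 / x ^ 2 + 3 / x ^ 3)) atTop
      (nhds (1 / 4)) := by
    have h1 := (tendsto_const_nhds (x := (2 : ℝ))).div_atTop (tendsto_id (α := ℝ))
    have h2 := (tendsto_const_nhds (x := (2 : ℝ))).div_atTop
      (tendsto_pow_atTop (α := ℝ) (n := 2) (by norm_num))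
    have h3 := (tendsto_const_nhds (x := (3 : ℝ))).div_atTop
      (tendsto_pow_atTop (α := ℝ) (n := 3) (by norm_num))
    have h4 := (((h1.const_sub 1).sub h2).add h3).const_mul (1 / 4)
    rwa [sub_zero, sub_zero, add_zero, mul_one] at h4
  refine le_of_tendsto' ((continuous_coe_real_ereal.tendsto _).comp (hlim.comp hodd)) fun j => ?_
  have h3 : (3 : ℝ) ≤ ((2 * j + 3 : ℕ) : ℝ) := by exact_mod_cast (by omega : 3 ≤ 2 * j + 3)
  refine (EReal.coe_le_coe_iff.2 (polynomial_le_lowerBound h3)).trans ?_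
  refine lowerBound_le_M hα (by omega) ⟨j + 1, by ring⟩ ?_
  have h4 : ((2 * j + 1 : ℕ) : ℕ∞) < liminfPartQuot α := by rw [h]; exact ENat.natCast_lt_top _
  filter_upwards [eventually_le_partQuot h4] with i hi
  push_cast at hi ⊢
  linarith

theorem eventually_two_le_partQuot {α : ℝ} (hα : Irrational α)
    (h : {i : ℕ | 1 ≤ i ∧ partQuot α i = 1}.Finite) :
    ∀ᶠ i in atTop, ((3 : ℕ) : ℤ) - 1 ≤ partQuot α i := by
  obtain ⟨b, hb⟩ := h.bddAbove
  filter_upwards [eventually_gt_atTop b, eventually_ge_atTop 1] with i hi hi1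
  obtain ⟨k, rfl⟩ : ∃ k, i = k + 1 := ⟨i - 1, by omega⟩
  have h1 := one_le_partQuot_succ hα k
  have h2 : partQuot α (k + 1) ≠ 1 := fun h => absurd (hb ⟨hi1, h⟩) (by omega)
  push_cast
  omega

theorem M_gammaStarStar_le_rho {α : ℝ} (hα : Irrational α)
    (h : {i : ℕ | 1 ≤ i ∧ partQuot α i = 1}.Finite) :
    M α (gammaStarStar α) ≤ rho α := by
  obtain ⟨k₁, hC⟩ := exists_cellData_of_eventually hα le_rfl (by decide)
    (eventually_two_le_partQuot hα h)
  exact le_iSup₂_of_le (gammaStarStar α)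
    (fun ⟨m, n, hmn⟩ => gammaStarStar_ne hα hC n m hmn) le_rfl

end Inhom

end

theorem theorem5 (α : ℝ) (hα : Irrational α) :
    Summable (Inhom.gammaTerm α) ∧
    (∀ R : ℕ, 2 ≤ R → Inhom.liminfPartQuot α = (R : ℕ∞) →
      (((1 / 4) * (1 - 2 / (Inhom.Rstar R : ℝ)) *
          (1 - 2 * Inhom.theta1 R ^ 2 - Inhom.theta1 R ^ 3) : ℝ) : EReal)
        ≤ Inhom.M α (Inhom.gammaStarStar α) ∧
      (1 / 4) * (1 - 2 / (Inhom.Rstar R : ℝ) - 2 / (Inhom.Rstar R : ℝ) ^ 2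
          + 3 / (Inhom.Rstar R : ℝ) ^ 3)
        ≤ (1 / 4) * (1 - 2 / (Inhom.Rstar R : ℝ)) *
          (1 - 2 * Inhom.theta1 R ^ 2 - Inhom.theta1 R ^ 3)) ∧
    (Inhom.liminfPartQuot α = ⊤ →
      ((1 / 4 : ℝ) : EReal) ≤ Inhom.M α (Inhom.gammaStarStar α)) ∧
    ({i : ℕ | 1 ≤ i ∧ Inhom.partQuot α i = 1}.Finite →
      ((1 / (2 * √13 + 8) : ℝ) : EReal) ≤ Inhom.M α (Inhom.gammaStarStar α) ∧
      Inhom.M α (Inhom.gammaStarStar α) ≤ Inhom.rho α) := by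
  refine ⟨(Inhom.hasSum_gammaTerm hα).summable, fun R hR h => ⟨?_, ?_⟩,
    Inhom.quarter_le_M hα, fun h => ⟨?_, Inhom.M_gammaStarStar_le_rho hα h⟩⟩
  · exact Inhom.lowerBound_Rstar_le_M hα hR h
  · refine Inhom.polynomial_le_lowerBound ?_
    have : 3 ≤ Inhom.Rstar R := by
      unfold Inhom.Rstar
      split_ifs with ho
      · obtain ⟨u, hu⟩ := ho; omega
      · omega
    exact_mod_cast this
  · have := Inhom.lowerBound_le_M hα le_rfl (by decide) (Inhom.eventually_two_le_partQuot hα h)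
    rwa [Nat.cast_ofNat, Inhom.lowerBound_three] at this
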